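/- Let $E,F$ be (real) Riesz spaces and $m\ge 1$. For a Riesz space $G$ let $G^{\sim}$ be its order dual, the Riesz space of order bounded linear functionals on $G$ (with $f\le g$ iff $f(x)\le g(x)$ for all $x\ge 0$), and $G^{\sim\sim}=(G^{\sim})^{\sim}$. An $m$-linear operator between Riesz spaces is positive if it maps tuples of positive vectors to positive vectors, and regular if it is the difference of two positive $m$-linear operators. A map $P\colon E\to F$ is an $m$-homogeneous polynomial if $P(x)=A(x,\dots,x)$ for some $m$-linear $A\colon E^m\to F$; $\check P$ denotes the unique symmetric such $A$. $P$ is positive if $\check P$ is positive, and regular if it is the difference of two positive $m$-homogeneous polynomials. For a permutation $\rho$ of $\{1,\dots,m\}$ and a regular $m$-linear $A\colon E^m\to F$, the Arens extension $AR^\rho_m(A)\colon (E^{\sim\sim})^m\to F^{\sim\sim}$ is given by $$AR_m^\rho(A)(x_1'',\dots,x_m'')(y')=\big(\overline{x''_{\rho(m)}}^{\rho}\circ\cdots\circ\overline{x''_{\rho(1)}}^{\rho}\big)(y'\circ A)\qquad(y'\in F^{\sim}),$$ where $\overline{x''_{\rho(k)}}^{\rho}$ maps a regular multilinear form $B$ in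 the variables with indices in $\{1,\dots,m\}\setminus\{\rho(1),\dots,\rho(k-1)\}$ to the regular form in the variables with indices in $\{1,\dots,m\}\setminus\{\rho(1),\dots,\rho(k)\}$ whose value is obtained by applying $x''_{\rho(k)}$ to the functional in $E^{\sim}$ that $B$ defines in its $\rho(k)$-th variable when the other variables are fixed (for $k=m$ this value is the number $x''_{\rho(m)}(B)$). For a regular $m$-homogeneous polynomial $P$, put $AR_m^\rho(P)(x'')=AR_m^\rho(\check P)(x'',\dots,x'')$. In a Riesz space $X$, $y_\alpha\downarrow 0$ means that the net $(y_\alpha)$ is decreasing with infimum $0$. A net $(x_\alpha)_{\alpha\in\Omega}$ in $X$ is order convergent to $0$ if there is a net $(y_\alpha)_{\alpha\in\Omega}$ in $X$ with $y_\alpha\downarrow0$ and $|x_\alpha|\le y_\alpha$ for all $\alpha$; it is $1$-convergent to $0$ if there are such a net and $\alpha_0\in\Omega$ with $|x_\alpha|\le y_\alpha$ for all $\alpha\ge\alpha_0$; it is $2$-convergent to $0$ if there is a net $(y_\beta)_{\beta\in\Gamma}$ in $X$ with $y_\beta\downarrow 0$ such that for every $\beta$ there is $\alpha_0\in\Omega$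 with $|x_\alpha|\le y_\beta$ for all $\alpha\ge\alpha_0$. **Proposition.** Let $P\colon E\to F$ be a regular $m$-homogeneous polynomial. Then every Arens extension of $P$ is order continuous at the origin on $E^{\sim\sim}$, for each of the three notions of order convergence: for every permutation $\rho$ of $\{1,\dots,m\}$ and every net $(x''_\alpha)_{\alpha\in\Omega}$ in $E^{\sim\sim}$, if $(x''_\alpha)$ is order convergent ($1$-convergent, $2$-convergent) to $0$ in $E^{\sim\sim}$, then $\big(AR_m^\rho(P)(x''_\alpha)\big)$ is order convergent ($1$-convergent, $2$-convergent, respectively) to $0$ in $F^{\sim\sim}$. -/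

import Mathlib

noncomputable section

set_option linter.unusedSectionVars false

/-! ### The order dual of a Riesz space

A Riesz space is a real vector space `E` with
`[AddCommGroup E] [Lattice E] [IsOrderedAddMonoid E] [Module ℝ E] [IsOrderedModule ℝ E]`. -/

section RieszDual

variable (E : Type*) [AddCommGroup E] [Lattice E] [IsOrderedAddMonoid E] [Module ℝ E]
  [IsOrderedModule ℝ E]

/-- The order bounded linear functionals: those that map order intervals to bounded sets. -/
def orderBoundedFunctionals : Submodule ℝ (E →ₗ[ℝ] ℝ) where
  carrier := {f | ∀ a b : E, BddBelow (f '' Set.Icc a b) ∧ BddAbove (f '' Set.Icc a b)}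
  zero_mem' := by
    intro a b
    refine ⟨⟨0, ?_⟩, ⟨0, ?_⟩⟩ <;> rintro _ ⟨x, _, rfl⟩ <;> simp
  add_mem' := by
    intro f g hf hg a b
    obtain ⟨⟨l, hl⟩, ⟨u, hu⟩⟩ := hf a b
    obtain ⟨⟨l', hl'⟩, ⟨u', hu'⟩⟩ := hg a b
    refine ⟨⟨l + l', ?_⟩, ⟨u + u', ?_⟩⟩ <;> rintro _ ⟨x, hx, rfl⟩
    · exact add_le_add (hl ⟨x, hx, rfl⟩) (hl' ⟨x, hx, rfl⟩)
    · exact add_le_add (hu ⟨x, hx, rfl⟩) (hu' ⟨x, hx, rfl⟩)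
  smul_mem' := by
    intro c f hf a b
    obtain ⟨⟨l, hl⟩, ⟨u, hu⟩⟩ := hf a b
    rcases le_total 0 c with hc | hc
    · refine ⟨⟨c * l, ?_⟩, ⟨c * u, ?_⟩⟩ <;> rintro _ ⟨x, hx, rfl⟩
      · exact mul_le_mul_of_nonneg_left (hl ⟨x, hx, rfl⟩) hc
      · exact mul_le_mul_of_nonneg_left (hu ⟨x, hx, rfl⟩) hc
    · refine ⟨⟨c * u, ?_⟩, ⟨c * l, ?_⟩⟩ <;> rintro _ ⟨x, hx, rfl⟩
      · exact mul_le_mul_of_nonpos_left (hu ⟨x, hx, rfl⟩) hc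
      · exact mul_le_mul_of_nonpos_left (hl ⟨x, hx, rfl⟩) hc

/-- The order dual of the Riesz space `E`: the order bounded linear functionals on `E`, with
`f ≤ g` iff `f x ≤ g x` for all `x ≥ 0`. -/
def RieszDual : Type _ := orderBoundedFunctionals E

end RieszDual

namespace RieszDual

variable {E : Type*} [AddCommGroup E] [Lattice E] [IsOrderedAddMonoid E] [Module ℝ E]
  [IsOrderedModule ℝ E]

instance : AddCommGroup (RieszDual E) :=
  inferInstanceAs (AddCommGroup (orderBoundedFunctionals E))

instance : Module ℝ (RieszDual E) :=
  inferInstanceAs (Module ℝ (orderBoundedFunctionals E))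

/-- The linear functional underlying an element of the order dual. -/
def toLin (f : RieszDual E) : E →ₗ[ℝ] ℝ := f.1

instance : CoeFun (RieszDual E) (fun _ => E → ℝ) := ⟨fun f => f.toLin⟩

@[simp] theorem toLin_add (f g : RieszDual E) : (f + g).toLin = f.toLin + g.toLin := rfl

@[simp] theorem toLin_sub (f g : RieszDual E) : (f - g).toLin = f.toLin - g.toLin := rfl

@[simp] theorem toLin_neg (f : RieszDual E) : (-f).toLin = -f.toLin := rfl

@[simp] theorem toLin_zero : (0 : RieszDual E).toLin = 0 := rfl

@[simp] theorem toLin_smul (c : ℝ) (f : RieszDual E) : (c • f).toLin = c • f.toLin := rfl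

theorem ext_apply {f g : RieszDual E} (h : ∀ x, f x = g x) : f = g :=
  Subtype.ext (LinearMap.ext h)

theorem ext_nonneg {f g : RieszDual E} (h : ∀ x, 0 ≤ x → f x = g x) : f = g := by
  refine ext_apply fun x => ?_
  rw [← posPart_sub_negPart x, map_sub, map_sub, h _ (posPart_nonneg x), h _ (negPart_nonneg x)]

instance : PartialOrder (RieszDual E) where
  le f g := ∀ x : E, 0 ≤ x → f x ≤ g x
  le_refl f x _ := le_rfl
  le_trans f g h h₁ h₂ x hx := (h₁ x hx).trans (h₂ x hx)
  le_antisymm f g h₁ h₂ := ext_nonneg fun x hx => le_antisymm (h₁ x hx) (h₂ x hx)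

theorem le_iff {f g : RieszDual E} : f ≤ g ↔ ∀ x : E, 0 ≤ x → f x ≤ g x := Iff.rfl

theorem nonneg_iff {f : RieszDual E} : 0 ≤ f ↔ ∀ x : E, 0 ≤ x → 0 ≤ f x := Iff.rfl

instance : IsOrderedAddMonoid (RieszDual E) where
  add_le_add_left f g h k x hx := by
    simpa using h x hx

instance : IsOrderedModule ℝ (RieszDual E) where
  smul_le_smul_of_nonneg_left c hc f g h x hx := by
    simpa using mul_le_mul_of_nonneg_left (h x hx) hc
  smul_le_smul_of_nonneg_right f hf c d h x hx := by
    simpa using mul_le_mul_of_nonneg_right h (hf x hx)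

/-- A positive functional is order bounded. -/
def ofNonneg (f : E →ₗ[ℝ] ℝ) (hf : ∀ x, 0 ≤ x → 0 ≤ f x) : RieszDual E :=
  ⟨f, by
    have hmono : ∀ x y, x ≤ y → f x ≤ f y := fun x y h => by
      have := hf (y - x) (sub_nonneg.2 h)
      rw [map_sub] at this
      linarith
    intro a b
    refine ⟨⟨f a, ?_⟩, ⟨f b, ?_⟩⟩ <;> rintro _ ⟨x, hx, rfl⟩
    · exact hmono _ _ hx.1
    · exact hmono _ _ hx.2⟩

/-- `sup {f z | 0 ≤ z ≤ x}`, the value at `x ≥ 0` of the positive part of `f`. -/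
def posSup (f : RieszDual E) (x : E) : ℝ := sSup (f '' Set.Icc 0 x)

theorem le_posSup (f : RieszDual E) {x z : E} (h0 : 0 ≤ z) (hz : z ≤ x) : f z ≤ f.posSup x :=
  le_csSup (f.2 0 x).2 ⟨z, ⟨h0, hz⟩, rfl⟩

theorem posSup_le (f : RieszDual E) {x : E} {c : ℝ} (hx : 0 ≤ x)
    (h : ∀ z, 0 ≤ z → z ≤ x → f z ≤ c) : f.posSup x ≤ c := by
  refine csSup_le ⟨_, 0, ⟨le_rfl, hx⟩, rfl⟩ ?_
  rintro _ ⟨z, hz, rfl⟩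
  exact h z hz.1 hz.2

theorem posSup_nonneg (f : RieszDual E) {x : E} (hx : 0 ≤ x) : 0 ≤ f.posSup x := by
  simpa using f.le_posSup le_rfl hx

theorem posSup_add (f : RieszDual E) {x y : E} (hx : 0 ≤ x) (hy : 0 ≤ y) :
    f.posSup (x + y) = f.posSup x + f.posSup y := by
  apply le_antisymm
  · refine f.posSup_le (add_nonneg hx hy) fun z hz hzxy => ?_
    have h1 : z - z ⊓ x ≤ y := by
      rw [sub_le_comm]
      exact le_inf (sub_le_self _ hy) (sub_le_iff_le_add.2 hzxy)
    have h2 : f z = f (z ⊓ x) + f (z - z ⊓ x) := by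
      rw [← map_add, add_sub_cancel]
    rw [h2]
    exact add_le_add (f.le_posSup (le_inf hz hx) inf_le_right)
      (f.le_posSup (sub_nonneg.2 inf_le_left) h1)
  · rw [← le_sub_iff_add_le]
    refine f.posSup_le hx fun z hz hzx => ?_
    rw [le_sub_comm]
    refine f.posSup_le hy fun w hw hwy => ?_
    rw [le_sub_iff_add_le, ← map_add]
    refine f.le_posSup (add_nonneg hw hz) ?_
    rw [add_comm w z]
    exact add_le_add hzx hwy

theorem posSup_smul (f : RieszDual E) {c : ℝ} (hc : 0 ≤ c) {x : E} (hx : 0 ≤ x) :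
    f.posSup (c • x) = c * f.posSup x := by
  have key : ∀ {d : ℝ}, 0 ≤ d → ∀ {y : E}, 0 ≤ y → d * f.posSup y ≤ f.posSup (d • y) := by
    intro d hd y hy
    rcases hd.eq_or_lt with rfl | hd
    · simpa using f.posSup_nonneg (x := (0 : ℝ) • y) (by simp)
    · rw [mul_comm, ← le_div_iff₀ hd]
      refine f.posSup_le hy fun z hz hzy => ?_
      rw [le_div_iff₀ hd, mul_comm]
      have : d * f z = f (d • z) := by simp
      rw [this]
      exact f.le_posSup (smul_nonneg hd.le hz) (smul_le_smul_of_nonneg_left hzy hd.le)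
  refine le_antisymm ?_ (key hc hx)
  rcases hc.eq_or_lt with rfl | hc
  · rw [zero_smul, zero_mul]
    refine f.posSup_le le_rfl fun z hz hz' => ?_
    rw [le_antisymm hz' hz, map_zero]
  · have := key (inv_nonneg.2 hc.le) (smul_nonneg hc.le hx)
    rwa [inv_smul_smul₀ hc.ne', inv_mul_le_iff₀ hc] at this

theorem posSup_sub_eq (f : RieszDual E) {a b c d : E} (ha : 0 ≤ a) (hb : 0 ≤ b) (hc : 0 ≤ c)
    (hd : 0 ≤ d) (h : a - b = c - d) :
    f.posSup a - f.posSup b = f.posSup c - f.posSup d := by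
  have h' : a + d = c + b := by rwa [sub_eq_sub_iff_add_eq_add] at h
  have := congrArg f.posSup h'
  rw [f.posSup_add ha hd, f.posSup_add hc hb] at this
  linarith

/-- The positive part of an order bounded functional, as a linear functional. -/
def posLin (f : RieszDual E) : E →ₗ[ℝ] ℝ where
  toFun x := f.posSup x⁺ - f.posSup x⁻
  map_add' x y := by
    have := f.posSup_sub_eq (posPart_nonneg (x + y)) (negPart_nonneg (x + y))
      (add_nonneg (posPart_nonneg x) (posPart_nonneg y))
      (add_nonneg (negPart_nonneg x) (negPart_nonneg y)) (by
        rw [posPart_sub_negPart, add_sub_add_comm, posPart_sub_negPart, posPart_sub_negPart])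
    rw [this, f.posSup_add (posPart_nonneg x) (posPart_nonneg y),
      f.posSup_add (negPart_nonneg x) (negPart_nonneg y)]
    ring
  map_smul' c x := by
    rw [RingHom.id_apply, smul_eq_mul]
    rcases le_total 0 c with hc | hc
    · have := f.posSup_sub_eq (posPart_nonneg (c • x)) (negPart_nonneg (c • x))
        (smul_nonneg hc (posPart_nonneg x)) (smul_nonneg hc (negPart_nonneg x)) (by
          rw [posPart_sub_negPart, ← smul_sub, posPart_sub_negPart])
      rw [this, f.posSup_smul hc (posPart_nonneg x), f.posSup_smul hc (negPart_nonneg x)]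
      ring
    · have hc' : 0 ≤ -c := neg_nonneg.2 hc
      have := f.posSup_sub_eq (posPart_nonneg (c • x)) (negPart_nonneg (c • x))
        (smul_nonneg hc' (negPart_nonneg x)) (smul_nonneg hc' (posPart_nonneg x)) (by
          rw [posPart_sub_negPart, ← smul_sub, ← neg_sub x⁺ x⁻, posPart_sub_negPart,
            smul_neg, neg_smul, neg_neg])
      rw [this, f.posSup_smul hc' (posPart_nonneg x), f.posSup_smul hc' (negPart_nonneg x)]
      ring

theorem posLin_apply (f : RieszDual E) {x : E} (hx : 0 ≤ x) : f.posLin x = f.posSup x := by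
  have h := f.posSup_sub_eq (posPart_nonneg x) (negPart_nonneg x) hx le_rfl (by
    rw [posPart_sub_negPart, sub_zero])
  have h0 : f.posSup 0 = 0 := by simpa using f.posSup_add (x := 0) (y := 0) le_rfl le_rfl
  rw [h0, sub_zero] at h
  exact h

/-- The supremum of `f` and `0` in the order dual. -/
def sup0 (f : RieszDual E) : RieszDual E :=
  ofNonneg f.posLin fun _ hx => (f.posLin_apply hx).symm ▸ f.posSup_nonneg hx

theorem sup0_apply (f : RieszDual E) {x : E} (hx : 0 ≤ x) :
    f.sup0 x = sSup (f '' Set.Icc 0 x) := f.posLin_apply hx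

theorem sup0_nonneg (f : RieszDual E) : 0 ≤ f.sup0 := fun x hx => by
  rw [sup0_apply f hx]
  exact f.posSup_nonneg hx

theorem le_sup0 (f : RieszDual E) : f ≤ f.sup0 := fun x hx => by
  rw [sup0_apply f hx]
  exact f.le_posSup hx le_rfl

theorem sup0_le {f g : RieszDual E} (hfg : f ≤ g) (hg : 0 ≤ g) : f.sup0 ≤ g := fun x hx => by
  rw [sup0_apply f hx]
  refine f.posSup_le hx fun z hz hzx => (hfg z hz).trans ?_
  have : 0 ≤ g (x - z) := hg (x - z) (sub_nonneg.2 hzx)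
  rw [map_sub] at this
  linarith

/-- The order dual is a lattice (Riesz and Kantorovich); the lattice operations are those of
the partial order above. -/
instance : Lattice (RieszDual E) where
  sup f g := g + (f - g).sup0
  inf f g := f - (f - g).sup0
  le_sup_left f g := by
    have := le_sup0 (f - g)
    rwa [sub_le_iff_le_add'] at this
  le_sup_right f g := le_add_of_nonneg_right (sup0_nonneg _)
  sup_le f g h hf hg := by
    rw [← le_sub_iff_add_le']
    exact sup0_le (sub_le_sub_right hf g) (sub_nonneg.2 hg)
  inf_le_left f g := sub_le_self _ (sup0_nonneg _)
  inf_le_right f g := by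
    have := le_sup0 (f - g)
    rwa [sub_le_comm] at this
  le_inf h f g hf hg := by
    rw [le_sub_comm]
    exact sup0_le (sub_le_sub_left hg f) (sub_nonneg.2 hf)

end RieszDual

/-! ### Order convergence of nets -/

section OrderConvergence

universe u

variable {X : Type*} [AddCommGroup X] [Lattice X]

/-- `y_α ↓ 0`: the net `y` is decreasing with infimum `0`. -/
def DecreasesToZero {Ω : Type*} [Preorder Ω] (y : Ω → X) : Prop :=
  Antitone y ∧ IsGLB (Set.range y) 0

/-- Order convergence: `|x_α - a| ≤ y_α` for every `α`, for some `y_α ↓ 0`. -/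
def OrderConv {Ω : Type*} [Preorder Ω] (x : Ω → X) (a : X) : Prop :=
  ∃ y : Ω → X, DecreasesToZero y ∧ ∀ α, |x α - a| ≤ y α

/-- `1`-convergence: `|x_α - a| ≤ y_α` for all `α ≥ α₀`, for some `α₀` and some `y_α ↓ 0`. -/
def OrderConv₁ {Ω : Type*} [Preorder Ω] (x : Ω → X) (a : X) : Prop :=
  ∃ (y : Ω → X) (α₀ : Ω), DecreasesToZero y ∧ ∀ α, α₀ ≤ α → |x α - a| ≤ y α

/-- `2`-convergence: there is a net `y_β ↓ 0`, over a directed set `Γ` of its own, such that for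
every `β` eventually `|x_α - a| ≤ y_β`. (Taking `Γ` in the universe of `X` is no restriction:
`Γ` can be replaced by the range of `y`, ordered by reversing the order of `X`.) -/
def OrderConv₂ {X : Type u} [AddCommGroup X] [Lattice X] {Ω : Type*} [Preorder Ω] (x : Ω → X)
    (a : X) : Prop :=
  ∃ (Γ : Type u) (_ : Preorder Γ) (_ : IsDirectedOrder Γ) (_ : Nonempty Γ) (y : Γ → X),
    DecreasesToZero y ∧ ∀ β, ∃ α₀ : Ω, ∀ α, α₀ ≤ α → |x α - a| ≤ y β

end OrderConvergence

/-! ### Regular multilinear operators -/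

section Regular

variable {E F : Type*} [AddCommGroup E] [Lattice E] [IsOrderedAddMonoid E] [Module ℝ E]
  [IsOrderedModule ℝ E] [AddCommGroup F] [Lattice F] [IsOrderedAddMonoid F] [Module ℝ F]
  [IsOrderedModule ℝ F]

/-- An `m`-linear operator is positive if it maps positive vectors to positive vectors. -/
def IsPositiveMultilinear {m : ℕ} (A : MultilinearMap ℝ (fun _ : Fin m => E) F) : Prop :=
  ∀ v : Fin m → E, (∀ i, 0 ≤ v i) → 0 ≤ A v

theorem IsPositiveMultilinear.add {m : ℕ} {A B : MultilinearMap ℝ (fun _ : Fin m => E) F}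
    (hA : IsPositiveMultilinear A) (hB : IsPositiveMultilinear B) :
    IsPositiveMultilinear (A + B) := fun v hv => add_nonneg (hA v hv) (hB v hv)

theorem IsPositiveMultilinear.smul {m : ℕ} {A : MultilinearMap ℝ (fun _ : Fin m => E) F}
    (hA : IsPositiveMultilinear A) {c : ℝ} (hc : 0 ≤ c) : IsPositiveMultilinear (c • A) :=
  fun v hv => smul_nonneg hc (hA v hv)

/-- The regular `m`-linear operators: the differences of two positive `m`-linear operators. -/
def regularMultilinear (m : ℕ) (E F : Type*) [AddCommGroup E] [Lattice E]
    [IsOrderedAddMonoid E] [Module ℝ E] [IsOrderedModule ℝ E] [AddCommGroup F] [Lattice F] [IsOrderedAddMonoid F] [Module ℝ F] [IsOrderedModule ℝ F] :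
    Submodule ℝ (MultilinearMap ℝ (fun _ : Fin m => E) F) where
  carrier := {A | ∃ A₁ A₂, IsPositiveMultilinear A₁ ∧ IsPositiveMultilinear A₂ ∧ A = A₁ - A₂}
  zero_mem' := ⟨0, 0, fun _ _ => le_rfl, fun _ _ => le_rfl, by simp⟩
  add_mem' := by
    rintro _ _ ⟨A₁, A₂, h₁, h₂, rfl⟩ ⟨B₁, B₂, k₁, k₂, rfl⟩
    exact ⟨A₁ + B₁, A₂ + B₂, h₁.add k₁, h₂.add k₂, by abel⟩
  smul_mem' := by
    rintro c _ ⟨A₁, A₂, h₁, h₂, rfl⟩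
    rcases le_total 0 c with hc | hc
    · exact ⟨c • A₁, c • A₂, h₁.smul hc, h₂.smul hc, by rw [smul_sub]⟩
    · refine ⟨(-c) • A₂, (-c) • A₁, h₂.smul (neg_nonneg.2 hc), h₁.smul (neg_nonneg.2 hc), ?_⟩
      rw [smul_sub, neg_smul, neg_smul]
      abel

/-- The space `L_r(E, …, E; F)` of regular `m`-linear operators. -/
def RegularMultilinear (m : ℕ) (E F : Type*) [AddCommGroup E] [Lattice E]
    [IsOrderedAddMonoid E] [Module ℝ E] [IsOrderedModule ℝ E] [AddCommGroup F]
    [Lattice F] [IsOrderedAddMonoid F] [Module ℝ F] [IsOrderedModule ℝ F] : Type _ :=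
  regularMultilinear m E F

instance {m : ℕ} : AddCommGroup (RegularMultilinear m E F) :=
  inferInstanceAs (AddCommGroup (regularMultilinear m E F))

instance {m : ℕ} : Module ℝ (RegularMultilinear m E F) :=
  inferInstanceAs (Module ℝ (regularMultilinear m E F))

theorem IsPositiveMultilinear.curryLeft {n : ℕ}
    {A : MultilinearMap ℝ (fun _ : Fin (n + 1) => E) F} (hA : IsPositiveMultilinear A) {x : E}
    (hx : 0 ≤ x) : IsPositiveMultilinear (A.curryLeft x) := fun v hv =>
  hA (Fin.cons x v) fun i => by refine Fin.cases ?_ ?_ i <;> simp [hx, hv]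

theorem IsPositiveMultilinear.abs_le : ∀ {n : ℕ} {A : MultilinearMap ℝ (fun _ : Fin n => E) F},
    IsPositiveMultilinear A → ∀ v : Fin n → E, |A v| ≤ A fun i => |v i|
  | 0, A, hA, v => by
    have h := hA v fun i => i.elim0
    rw [abs_of_nonneg h, Subsingleton.elim (fun i => |v i|) v]
  | n + 1, A, hA, v => by
    have hv : A v = A.curryLeft (v 0)⁺ (fun i => v i.succ)
        - A.curryLeft (v 0)⁻ (fun i => v i.succ) := by
      rw [← _root_.sub_apply, ← map_sub, posPart_sub_negPart]
      exact congrArg A (Fin.cons_self_tail v).symm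
    have hv' : (A fun i => |v i|) = A.curryLeft (v 0)⁺ (fun i => |v i.succ|)
        + A.curryLeft (v 0)⁻ (fun i => |v i.succ|) := by
      rw [← _root_.add_apply, ← map_add, posPart_add_negPart]
      exact congrArg A (Fin.cons_self_tail fun i => |v i|).symm
    rw [hv, hv', sub_eq_add_neg]
    refine (abs_add_le _ _).trans ?_
    rw [abs_neg]
    exact add_le_add ((hA.curryLeft (posPart_nonneg (v 0))).abs_le _)
      ((hA.curryLeft (negPart_nonneg (v 0))).abs_le _)

/-- For a regular `(n+1)`-linear form `A`, the functional `A(•, v₁, …, vₙ)` of the order dual. -/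
def regularSlice {n : ℕ} (A : RegularMultilinear (n + 1) E ℝ) (v : Fin n → E) :
    RieszDual E :=
  ⟨{ toFun := fun x => A.1 (Fin.cons x v)
     map_add' := fun x y => by
      change A.1.curryLeft (x + y) v = A.1.curryLeft x v + A.1.curryLeft y v
      rw [map_add, _root_.add_apply]
     map_smul' := fun c x => by
      change A.1.curryLeft (c • x) v = c • A.1.curryLeft x v
      rw [map_smul, _root_.smul_apply] }, by
    obtain ⟨A, A₁, A₂, h₁, h₂, rfl⟩ := A
    have key : ∀ {B : MultilinearMap ℝ (fun _ : Fin (n + 1) => E) ℝ}, IsPositiveMultilinear B →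
        ∀ a b x : E, x ∈ Set.Icc a b →
          |B (Fin.cons x v)| ≤ B.curryLeft (|a| + |b|) (fun i => |v i|) := by
      intro B hB a b x hx
      have hxab : |x| ≤ |a| + |b| := abs_le'.2
        ⟨(hx.2.trans (le_abs_self b)).trans (le_add_of_nonneg_left (abs_nonneg a)),
          ((neg_le_neg hx.1).trans (neg_le_abs a)).trans (le_add_of_nonneg_right (abs_nonneg b))⟩
      have h1 : (fun i => |(Fin.cons x v : Fin (n + 1) → E) i|)
          = (Fin.cons |x| (fun i => |v i|) : Fin (n + 1) → E) := by
        funext i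
        refine Fin.cases ?_ (fun j => ?_) i <;> simp
      have h2 := hB.abs_le (Fin.cons x v)
      rw [h1] at h2
      have h3 := hB.curryLeft (sub_nonneg.2 hxab) (fun i => |v i|) fun i => abs_nonneg _
      rw [map_sub, _root_.sub_apply] at h3
      exact h2.trans (sub_nonneg.1 h3)
    intro a b
    refine ⟨⟨-(A₁.curryLeft (|a| + |b|) (fun i => |v i|)
        + A₂.curryLeft (|a| + |b|) (fun i => |v i|)), ?_⟩,
      ⟨A₁.curryLeft (|a| + |b|) (fun i => |v i|)
        + A₂.curryLeft (|a| + |b|) (fun i => |v i|), ?_⟩⟩ <;>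
    · rintro _ ⟨x, hx, rfl⟩
      have e₁ := _root_.abs_le.1 (key h₁ a b x hx)
      have e₂ := _root_.abs_le.1 (key h₂ a b x hx)
      change _ ≤ _
      simp only [LinearMap.coe_mk, AddHom.coe_mk, _root_.sub_apply]
      linarith [e₁.1, e₁.2, e₂.1, e₂.2]⟩

theorem regularSlice_apply {n : ℕ} (A : RegularMultilinear (n + 1) E ℝ)
    (v : Fin n → E) (x : E) : regularSlice A v x = A.1 (Fin.cons x v) := rfl

theorem regularSlice_add {n : ℕ} (A B : RegularMultilinear (n + 1) E ℝ)
    (v : Fin n → E) : regularSlice (A + B) v = regularSlice A v + regularSlice B v := rfl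

theorem regularSlice_smul {n : ℕ} (c : ℝ) (A : RegularMultilinear (n + 1) E ℝ)
    (v : Fin n → E) : regularSlice (c • A) v = c • regularSlice A v := rfl

theorem regularSlice_nonneg {n : ℕ} {A : RegularMultilinear (n + 1) E ℝ}
    (hA : IsPositiveMultilinear A.1) {v : Fin n → E} (hv : ∀ i, 0 ≤ v i) : 0 ≤ regularSlice A v :=
  fun _ hx => hA.curryLeft hx v hv

end Regular

/-! ### Arens extensions -/

section Arens

variable {E F : Type*} [AddCommGroup E] [Lattice E] [IsOrderedAddMonoid E] [Module ℝ E]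
  [IsOrderedModule ℝ E] [AddCommGroup F] [Lattice F] [IsOrderedAddMonoid F] [Module ℝ F]
  [IsOrderedModule ℝ F]

/-- The multilinear form `v ↦ x''(A(•, v₁, …, vₙ))`. -/
def arensBarForm {n : ℕ} (x'' : RieszDual (RieszDual E)) (A : RegularMultilinear (n + 1) E ℝ) :
    MultilinearMap ℝ (fun _ : Fin n => E) ℝ where
  toFun v := x'' (regularSlice A v)
  map_update_add' v i a b := by
    rw [← map_add]
    congr 1
    refine RieszDual.ext_apply fun x => ?_
    exact (A.1.curryLeft x).map_update_add v i a b
  map_update_smul' v i c a := by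
    rw [← map_smul]
    congr 1
    refine RieszDual.ext_apply fun x => ?_
    exact (A.1.curryLeft x).map_update_smul v i c a

theorem arensBarForm_nonneg {n : ℕ} {x'' : RieszDual (RieszDual E)} (hx : 0 ≤ x'')
    {A : RegularMultilinear (n + 1) E ℝ} (hA : IsPositiveMultilinear A.1) :
    IsPositiveMultilinear (arensBarForm x'' A) :=
  fun _ hv => hx _ (regularSlice_nonneg hA hv)

theorem arensBarForm_sub {n : ℕ} (x'' y'' : RieszDual (RieszDual E))
    (A : RegularMultilinear (n + 1) E ℝ) :
    arensBarForm (x'' - y'') A = arensBarForm x'' A - arensBarForm y'' A := rfl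

theorem arensBarForm_nonneg_mem {n : ℕ} {x'' : RieszDual (RieszDual E)} (hx : 0 ≤ x'')
    (A : RegularMultilinear (n + 1) E ℝ) :
    arensBarForm x'' A ∈ regularMultilinear n E ℝ := by
  obtain ⟨A, A₁, A₂, h₁, h₂, rfl⟩ := A
  let B₁ : RegularMultilinear (n + 1) E ℝ := ⟨A₁, A₁, 0, h₁, fun _ _ => le_rfl, by simp⟩
  let B₂ : RegularMultilinear (n + 1) E ℝ := ⟨A₂, A₂, 0, h₂, fun _ _ => le_rfl, by simp⟩
  refine ⟨arensBarForm x'' B₁, arensBarForm x'' B₂, arensBarForm_nonneg hx h₁,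
    arensBarForm_nonneg hx h₂, ?_⟩
  ext v
  change x'' _ = x'' (regularSlice B₁ v) - x'' (regularSlice B₂ v)
  rw [← map_sub]
  rfl

/-- The linear operator from regular `(n+1)`-linear forms to regular `n`-linear forms given by
`A ↦ (v ↦ x''(A(•, v₁, …, vₙ)))`. -/
def arensBar {n : ℕ} (x'' : RieszDual (RieszDual E)) :
    RegularMultilinear (n + 1) E ℝ →ₗ[ℝ] RegularMultilinear n E ℝ where
  toFun A := ⟨arensBarForm x'' A, by
    rw [← posPart_sub_negPart x'', arensBarForm_sub]
    exact Submodule.sub_mem _ (arensBarForm_nonneg_mem (posPart_nonneg x'') A)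
      (arensBarForm_nonneg_mem (negPart_nonneg x'') A)⟩
  map_add' A B := by
    refine Subtype.ext (MultilinearMap.ext fun v => ?_)
    change x'' (regularSlice (A + B) v) = x'' (regularSlice A v) + x'' (regularSlice B v)
    rw [regularSlice_add, map_add]
  map_smul' c A := by
    refine Subtype.ext (MultilinearMap.ext fun v => ?_)
    change x'' (regularSlice (c • A) v) = c • x'' (regularSlice A v)
    rw [regularSlice_smul, map_smul]

theorem arensBar_sub {n : ℕ} (x'' y'' : RieszDual (RieszDual E))
    (A : RegularMultilinear (n + 1) E ℝ) :
    arensBar (x'' - y'') A = arensBar x'' A - arensBar y'' A := rfl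

/-- The composition of the operators attached to `x''₀, x''₁, …, x''ₙ₋₁` (that of `x''₀` is
applied first, to the first variable; then that of `x''₁`, to the first remaining variable, and
so on), with values in the `0`-linear forms, that is, in `ℝ`. -/
def arensIter : (n : ℕ) → (Fin n → RieszDual (RieszDual E)) → RegularMultilinear n E ℝ →ₗ[ℝ] ℝ
  | 0, _ => { toFun := fun A => A.1 Fin.elim0
              map_add' := fun _ _ => rfl
              map_smul' := fun _ _ => rfl }
  | n + 1, x => arensIter n (fun i => x i.succ) ∘ₗ arensBar (x 0)

/-- The composition `arensIter` is a regular functional. -/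
theorem arensIter_regular : ∀ (n : ℕ) (x : Fin n → RieszDual (RieszDual E)),
    ∃ T₁ T₂ : RegularMultilinear n E ℝ →ₗ[ℝ] ℝ,
      (∀ A, IsPositiveMultilinear A.1 → 0 ≤ T₁ A) ∧
      (∀ A, IsPositiveMultilinear A.1 → 0 ≤ T₂ A) ∧ arensIter n x = T₁ - T₂
  | 0, x => ⟨arensIter 0 x, 0, fun A hA => hA _ fun i => i.elim0, fun _ _ => le_rfl, by simp⟩
  | n + 1, x => by
    obtain ⟨T₁, T₂, h₁, h₂, h⟩ := arensIter_regular n fun i => x i.succ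
    have hp := posPart_nonneg (x 0)
    have hn := negPart_nonneg (x 0)
    refine ⟨T₁ ∘ₗ arensBar (x 0)⁺ + T₂ ∘ₗ arensBar (x 0)⁻,
      T₁ ∘ₗ arensBar (x 0)⁻ + T₂ ∘ₗ arensBar (x 0)⁺, fun A hA => ?_, fun A hA => ?_, ?_⟩
    · exact add_nonneg (h₁ _ (arensBarForm_nonneg hp hA)) (h₂ _ (arensBarForm_nonneg hn hA))
    · exact add_nonneg (h₁ _ (arensBarForm_nonneg hn hA)) (h₂ _ (arensBarForm_nonneg hp hA))
    · refine LinearMap.ext fun A => ?_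
      have hx : arensBar (x 0) A = arensBar (x 0)⁺ A - arensBar (x 0)⁻ A := by
        rw [← arensBar_sub, posPart_sub_negPart]
      simp only [arensIter, h, hx, LinearMap.comp_apply, LinearMap.sub_apply,
        LinearMap.add_apply, map_sub]
      ring

theorem reindexComp_mem {m : ℕ} (ρ : Equiv.Perm (Fin m)) (A : RegularMultilinear m E F)
    (y' : RieszDual F) :
    (y'.toLin.compMultilinearMap A.1).domDomCongr ρ.symm ∈ regularMultilinear m E ℝ := by
  obtain ⟨A, A₁, A₂, h₁, h₂, rfl⟩ := A
  have pos : ∀ {z' : RieszDual F}, 0 ≤ z' → ∀ {B : MultilinearMap ℝ (fun _ : Fin m => E) F},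
      IsPositiveMultilinear B →
      IsPositiveMultilinear ((z'.toLin.compMultilinearMap B).domDomCongr ρ.symm) :=
    fun hz _ hB _ hv => hz _ (hB _ fun _ => hv _)
  refine ⟨((y'⁺).toLin.compMultilinearMap A₁).domDomCongr ρ.symm
      + ((y'⁻).toLin.compMultilinearMap A₂).domDomCongr ρ.symm,
    ((y'⁺).toLin.compMultilinearMap A₂).domDomCongr ρ.symm
      + ((y'⁻).toLin.compMultilinearMap A₁).domDomCongr ρ.symm,
    (pos (posPart_nonneg y') h₁).add (pos (negPart_nonneg y') h₂),
    (pos (posPart_nonneg y') h₂).add (pos (negPart_nonneg y') h₁), ?_⟩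
  ext v
  have hy : ∀ w, y' w = (y'⁺).toLin w - (y'⁻).toLin w := fun w => by
    rw [← LinearMap.sub_apply, ← RieszDual.toLin_sub, posPart_sub_negPart]
  simp only [MultilinearMap.domDomCongr_apply, LinearMap.compMultilinearMap_apply, hy,
    _root_.sub_apply, _root_.add_apply, map_sub]
  ring

/-- `y' ∘ A`, with its variables listed in the order `ρ(1), …, ρ(m)`: the form whose value at
`v` is `y'(A(x₁, …, xₘ))`, where `x_{ρ(i)} = vᵢ`. -/
def reindexComp {m : ℕ} (ρ : Equiv.Perm (Fin m)) (A : RegularMultilinear m E F) :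
    RieszDual F →ₗ[ℝ] RegularMultilinear m E ℝ where
  toFun y' := ⟨(y'.toLin.compMultilinearMap A.1).domDomCongr ρ.symm, reindexComp_mem ρ A y'⟩
  map_add' _ _ := rfl
  map_smul' _ _ := rfl

/-- The Arens extension of the regular `m`-linear operator `A` with respect to the permutation
`ρ`: at `(x''₁, …, x''ₘ)` and `y'` its value is
`(bar x''_{ρ(m)} ∘ ⋯ ∘ bar x''_{ρ(1)}) (y' ∘ A)`, where `bar x''_{ρ(k)}` evaluates `x''_{ρ(k)}` at
the functionals obtained by fixing all remaining variables but the `ρ(k)`-th. -/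
def arensExtension {m : ℕ} (ρ : Equiv.Perm (Fin m)) (A : RegularMultilinear m E F)
    (x'' : Fin m → RieszDual (RieszDual E)) : RieszDual (RieszDual F) :=
  ⟨arensIter m (fun i => x'' (ρ i)) ∘ₗ reindexComp ρ A, by
    obtain ⟨T₁, T₂, h₁, h₂, h⟩ := arensIter_regular m fun i => x'' (ρ i)
    rw [h]
    obtain ⟨A, A₁, A₂, k₁, k₂, rfl⟩ := A
    let B₁ : RegularMultilinear m E F := ⟨A₁, A₁, 0, k₁, fun _ _ => le_rfl, by simp⟩
    let B₂ : RegularMultilinear m E F := ⟨A₂, A₂, 0, k₂, fun _ _ => le_rfl, by simp⟩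
    have pos : ∀ {B : RegularMultilinear m E F}, IsPositiveMultilinear B.1 →
        ∀ y' : RieszDual F, 0 ≤ y' → IsPositiveMultilinear (reindexComp ρ B y').1 :=
      fun hB _ hy _ hv => hy _ (hB _ fun _ => hv _)
    have hB : (T₁ - T₂) ∘ₗ reindexComp ρ (⟨A₁ - A₂, A₁, A₂, k₁, k₂, rfl⟩ :
        RegularMultilinear m E F) = (T₁ ∘ₗ reindexComp ρ B₁ + T₂ ∘ₗ reindexComp ρ B₂)
          - (T₁ ∘ₗ reindexComp ρ B₂ + T₂ ∘ₗ reindexComp ρ B₁) := by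
      refine LinearMap.ext fun y' => ?_
      have hy : reindexComp ρ (⟨A₁ - A₂, A₁, A₂, k₁, k₂, rfl⟩ : RegularMultilinear m E F) y'
          = reindexComp ρ B₁ y' - reindexComp ρ B₂ y' :=
        Subtype.ext (MultilinearMap.ext fun v => map_sub y'.toLin _ _)
      simp only [hy, LinearMap.comp_apply, LinearMap.sub_apply, LinearMap.add_apply, map_sub]
      ring
    rw [hB]
    exact Submodule.sub_mem _
      (RieszDual.ofNonneg (T₁ ∘ₗ reindexComp ρ B₁ + T₂ ∘ₗ reindexComp ρ B₂) fun y' hy =>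
        add_nonneg (h₁ _ (pos k₁ y' hy)) (h₂ _ (pos k₂ y' hy))).2
      (RieszDual.ofNonneg (T₁ ∘ₗ reindexComp ρ B₂ + T₂ ∘ₗ reindexComp ρ B₁) fun y' hy =>
        add_nonneg (h₁ _ (pos k₂ y' hy)) (h₂ _ (pos k₁ y' hy))).2⟩

end Arens

/-! ### Homogeneous polynomials -/

section Polynomials

variable {E F : Type*} [AddCommGroup E] [Lattice E] [IsOrderedAddMonoid E] [Module ℝ E]
  [IsOrderedModule ℝ E] [AddCommGroup F] [Lattice F] [IsOrderedAddMonoid F] [Module ℝ F]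
  [IsOrderedModule ℝ F]

/-- `P` is an `m`-homogeneous polynomial: `P(x) = A(x, …, x)` for some `m`-linear `A`. -/
def IsHomogeneousPolynomial (m : ℕ) (P : E → F) : Prop :=
  ∃ A : MultilinearMap ℝ (fun _ : Fin m => E) F, ∀ x, P x = A fun _ => x

/-- Symmetry of an `m`-linear operator. -/
def IsSymmetricMultilinear {m : ℕ} (A : MultilinearMap ℝ (fun _ : Fin m => E) F) : Prop :=
  ∀ (σ : Equiv.Perm (Fin m)) (v : Fin m → E), A (fun i => v (σ i)) = A v

theorem IsHomogeneousPolynomial.exists_symmetric {m : ℕ} {P : E → F}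
    (hP : IsHomogeneousPolynomial m P) :
    ∃ A : MultilinearMap ℝ (fun _ : Fin m => E) F, IsSymmetricMultilinear A ∧
      ∀ x, P x = A fun _ => x := by
  obtain ⟨A, hA⟩ := hP
  have happ : ∀ v : Fin m → E, ((m.factorial : ℝ)⁻¹ •
      ∑ σ : Equiv.Perm (Fin m), A.domDomCongr σ) v
      = (m.factorial : ℝ)⁻¹ • ∑ σ : Equiv.Perm (Fin m), A fun i => v (σ i) := fun v => by
    rw [_root_.smul_apply, _root_.sum_apply]
    rfl
  refine ⟨(m.factorial : ℝ)⁻¹ • ∑ σ : Equiv.Perm (Fin m), A.domDomCongr σ, ?_, ?_⟩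
  · intro τ v
    rw [happ, happ]
    congr 1
    exact Fintype.sum_equiv (Equiv.mulLeft τ) _ _ fun σ => rfl
  · intro x
    rw [happ, Finset.sum_const, Finset.card_univ, Fintype.card_perm, Fintype.card_fin, hA x,
      ← Nat.cast_smul_eq_nsmul ℝ, smul_smul,
      inv_mul_cancel₀ (Nat.cast_ne_zero.2 m.factorial_ne_zero), one_smul]

/-- An alternating sum over the finite sets that contain `t`. -/
theorem polarAux {m : ℕ} (t : Finset (Fin m)) :
    ∑ s : Finset (Fin m), (if t ⊆ s then (-1 : ℝ) ^ s.card else 0)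
      = if t = Finset.univ then (-1 : ℝ) ^ m else 0 := by
  have h1 : ∑ s : Finset (Fin m), (if t ⊆ s then (-1 : ℝ) ^ s.card else 0)
      = ∑ s : Finset (Fin m), (if s ⊆ tᶜ then (-1 : ℝ) ^ m * (-1 : ℝ) ^ s.card else 0) := by
    refine Fintype.sum_equiv (compl_involutive (α := Finset (Fin m))).toPerm _ _ fun s => ?_
    have hs : (-1 : ℝ) ^ m * (-1 : ℝ) ^ sᶜ.card = (-1 : ℝ) ^ s.card := by
      have hc : s.card + sᶜ.card = m := by simp
      have he : m + sᶜ.card = s.card + 2 * sᶜ.card := by omega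
      rw [← pow_add, he, pow_add, pow_mul]
      norm_num
    simp only [Function.Involutive.coe_toPerm, Finset.compl_subset_compl, hs]
  have h2 := congrArg (Int.cast : ℤ → ℝ) (Finset.sum_powerset_neg_one_pow_card (x := tᶜ))
  push_cast at h2
  rw [h1, ← Finset.sum_filter, ← Finset.mul_sum]
  have h3 : (Finset.univ.filter fun s => s ⊆ tᶜ) = tᶜ.powerset := by
    ext s
    simp
  rw [h3, h2]
  simp

/-- A form of the polarization identity. -/
theorem IsSymmetricMultilinear.polarization {m : ℕ}
    {A : MultilinearMap ℝ (fun _ : Fin m => E) F} (hA : IsSymmetricMultilinear A)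
    (v : Fin m → E) :
    ∑ s : Finset (Fin m), (-1 : ℝ) ^ s.card • A (fun _ => ∑ i ∈ s, v i)
      = ((-1 : ℝ) ^ m * m.factorial) • A v := by
  have h1 : ∀ s : Finset (Fin m), (-1 : ℝ) ^ s.card • A (fun _ => ∑ i ∈ s, v i)
      = ∑ r : Fin m → Fin m, (if Finset.univ.image r ⊆ s then (-1 : ℝ) ^ s.card else 0)
          • A fun i => v (r i) := by
    intro s
    rw [A.map_sum_finset (fun _ j => v j) (fun _ => s), Finset.smul_sum]
    simp only [ite_smul, zero_smul]
    rw [← Finset.sum_filter]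
    refine Finset.sum_congr ?_ fun _ _ => rfl
    ext r
    simp [Fintype.mem_piFinset, Finset.image_subset_iff]
  simp only [h1]
  rw [Finset.sum_comm]
  simp only [← Finset.sum_smul, polarAux]
  simp only [ite_smul, zero_smul]
  rw [← Finset.sum_filter]
  have h2 : ∑ r : Fin m → Fin m with Finset.univ.image r = Finset.univ,
      (-1 : ℝ) ^ m • A (fun i => v (r i))
      = ∑ _σ : Equiv.Perm (Fin m), (-1 : ℝ) ^ m • A v := by
    symm
    refine Finset.sum_bij (fun σ _ => (σ : Fin m → Fin m)) ?_ ?_ ?_ ?_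
    · intro σ _
      simp [Finset.image_univ_of_surjective σ.surjective]
    · intro σ _ τ _ h
      exact DFunLike.coe_injective h
    · intro r hr
      have hs : Function.Surjective r := by
        simpa [Finset.eq_univ_iff_forall, Function.Surjective] using hr
      exact ⟨Equiv.ofBijective r (Finite.surjective_iff_bijective.1 hs), Finset.mem_univ _, rfl⟩
    · intro σ _
      rw [hA σ v]
  rw [h2, Finset.sum_const, Finset.card_univ, Fintype.card_perm, Fintype.card_fin,
    ← Nat.cast_smul_eq_nsmul ℝ, smul_smul, mul_comm]

theorem IsSymmetricMultilinear.ext_diag {m : ℕ} {A B : MultilinearMap ℝ (fun _ : Fin m => E) F}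
    (hA : IsSymmetricMultilinear A) (hB : IsSymmetricMultilinear B)
    (h : ∀ x, A (fun _ => x) = B fun _ => x) : A = B := by
  ext v
  have h₁ := hA.polarization v
  simp only [h] at h₁
  rw [hB.polarization v] at h₁
  have hne : ((-1 : ℝ) ^ m * m.factorial) ≠ 0 :=
    mul_ne_zero (pow_ne_zero _ (by norm_num)) (Nat.cast_ne_zero.2 m.factorial_ne_zero)
  exact (smul_right_injective F hne h₁).symm

/-- The symmetric `m`-linear operator associated with an `m`-homogeneous polynomial. -/
def IsHomogeneousPolynomial.assoc {m : ℕ} {P : E → F} (hP : IsHomogeneousPolynomial m P) :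
    MultilinearMap ℝ (fun _ : Fin m => E) F := hP.exists_symmetric.choose

theorem IsHomogeneousPolynomial.assoc_symmetric {m : ℕ} {P : E → F}
    (hP : IsHomogeneousPolynomial m P) : IsSymmetricMultilinear hP.assoc :=
  hP.exists_symmetric.choose_spec.1

theorem IsHomogeneousPolynomial.assoc_diag {m : ℕ} {P : E → F}
    (hP : IsHomogeneousPolynomial m P) (x : E) : hP.assoc (fun _ => x) = P x :=
  (hP.exists_symmetric.choose_spec.2 x).symm

/-- A positive `m`-homogeneous polynomial: its associated symmetric operator is positive. -/
def IsPositivePolynomial (m : ℕ) (P : E → F) : Prop :=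
  ∃ hP : IsHomogeneousPolynomial m P, IsPositiveMultilinear hP.assoc

/-- A regular `m`-homogeneous polynomial: the difference of two positive ones. -/
def IsRegularPolynomial (m : ℕ) (P : E → F) : Prop :=
  ∃ P₁ P₂ : E → F, IsPositivePolynomial m P₁ ∧ IsPositivePolynomial m P₂ ∧ P = P₁ - P₂

theorem IsRegularPolynomial.isHomogeneousPolynomial {m : ℕ} {P : E → F}
    (hP : IsRegularPolynomial m P) : IsHomogeneousPolynomial m P := by
  obtain ⟨P₁, P₂, ⟨h₁, _⟩, ⟨h₂, _⟩, rfl⟩ := hP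
  exact ⟨h₁.assoc - h₂.assoc, fun x => by
    rw [_root_.sub_apply, h₁.assoc_diag, h₂.assoc_diag, Pi.sub_apply]⟩

theorem IsRegularPolynomial.assoc_mem {m : ℕ} {P : E → F} (hP : IsRegularPolynomial m P) :
    hP.isHomogeneousPolynomial.assoc ∈ regularMultilinear m E F := by
  have hP' := hP
  obtain ⟨P₁, P₂, ⟨h₁, k₁⟩, ⟨h₂, k₂⟩, h⟩ := hP'
  refine ⟨h₁.assoc, h₂.assoc, k₁, k₂,
    hP.isHomogeneousPolynomial.assoc_symmetric.ext_diag (fun σ v => ?_) fun x => ?_⟩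
  · rw [_root_.sub_apply, _root_.sub_apply, h₁.assoc_symmetric σ v,
      h₂.assoc_symmetric σ v]
  · rw [_root_.sub_apply, h₁.assoc_diag, h₂.assoc_diag,
      hP.isHomogeneousPolynomial.assoc_diag, h, Pi.sub_apply]

/-- The Arens extension of a regular `m`-homogeneous polynomial `P` with respect to `ρ`: the
polynomial `x'' ↦ AR(A)(x'', …, x'')`, where `A` is the symmetric operator associated with `P`. -/
def IsRegularPolynomial.arensExtension {m : ℕ} {P : E → F} (hP : IsRegularPolynomial m P)
    (ρ : Equiv.Perm (Fin m)) (x'' : RieszDual (RieszDual E)) : RieszDual (RieszDual F) :=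
  _root_.arensExtension ρ ⟨hP.isHomogeneousPolynomial.assoc, hP.assoc_mem⟩ fun _ => x''

end Polynomials

/-! The argument rests on domination by a positive operator and on evaluating one functional at a
fixed point. Write the symmetric operator of `P` as `A₁ - A₂` with both terms positive, and put `B =
A₁ + A₂`. Then `B` plus or minus that operator is `2A₁` or `2A₂`, hence positive, and `|x''| ≤ y''`
implies `|AR(P)(x'')| ≤ AR(B)(y'', …, y'')` (`abs_arensExtension_le`,
`IsRegularPolynomial.exists_dominating`). A net that dominates `x''` is thus sent to one that
dominates its image, over the same index set. All three claims reduce to one: `y_α ↓ 0` implies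
`AR(B)(y_α, …, y_α) ↓ 0` (`DecreasesToZero.arensExtension`). The net `AR(B)(y_α, …, y_α)` is
positive and decreasing because the extension of `B` is monotone on positive tuples. For the
infimum, fix `f ≥ 0` in the order dual of `F` and an index `α₀`. For `α ≥ α₀`, replace `y_α` by the
larger `y_{α₀}` in every slot except the one evaluated last. Eliminating those slots from `f ∘ B`
leaves a linear functional `b` that does not depend on `α`, so the upper bound is `y_α(b)`
(`exists_arensIter_eq_last`). It tends to `0`, since decrease to zero in an order dual is pointwise
(`RieszDual.tendsto_apply_of_decreasesToZero`). The choice of the last slot is essential: for an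
earlier slot, the functionals applied afterwards would have to be order continuous. -/

namespace RieszDual

/-! ### Domination and pointwise limits in the order dual -/

section

variable {E : Type*} [AddCommGroup E] [Lattice E] [IsOrderedAddMonoid E] [Module ℝ E]
  [IsOrderedModule ℝ E]

/-- A functional dominated by `y` is dominated by `y b` on elements dominated by `b`. -/
theorem abs_apply_le {x y : RieszDual E} {b c : E} (hxy : |x| ≤ y) (h₁ : 0 ≤ b + c)
    (h₂ : 0 ≤ b - c) : |x c| ≤ y b := by
  obtain ⟨hx, hx'⟩ := abs_le'.1 hxy
  -- Adding `a₁` and `a₄` cancels `x b` and `y c` and leaves `2 x c ≤ 2 y b`; `a₂` and `a₃` give the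
  -- opposite bound in the same way.
  have a₁ := hx _ h₁
  have a₂ := hx' _ h₁
  have a₃ := hx _ h₂
  have a₄ := hx' _ h₂
  simp only [toLin_neg, LinearMap.neg_apply, map_add, map_sub] at a₁ a₂ a₃ a₄
  exact abs_le.2 ⟨by linarith, by linarith⟩

/-- A net that decreases to zero in the order dual decreases to zero pointwise. -/
theorem tendsto_apply_of_decreasesToZero {Ω : Type*} [Preorder Ω] [IsDirectedOrder Ω]
    [Nonempty Ω] {y : Ω → RieszDual E} (hy : DecreasesToZero y) (x : E) :
    Filter.Tendsto (fun α => y α x) Filter.atTop (nhds 0) := by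
  have hnn : ∀ α, 0 ≤ y α := fun α => hy.2.1 ⟨α, rfl⟩
  -- At a positive point the values form a decreasing net of reals bounded below by `0`; a general
  -- point is the difference of its positive and negative parts.
  have hpos : ∀ z : E, 0 ≤ z →
      Filter.Tendsto (fun α => y α z) Filter.atTop (nhds (⨅ α, y α z)) := fun z hz =>
    tendsto_atTop_ciInf (fun _ _ h => hy.1 h z hz) ⟨0, by
      rintro _ ⟨α, rfl⟩
      exact hnn α z hz⟩
  have hex : ∀ z : E, ∃ l : ℝ, Filter.Tendsto (fun α => y α z) Filter.atTop (nhds l) := by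
    intro z
    refine ⟨_, ((hpos _ (posPart_nonneg z)).sub (hpos _ (negPart_nonneg z))).congr fun α => ?_⟩
    rw [← map_sub, posPart_sub_negPart]
  choose L hL using hex
  let f : E →ₗ[ℝ] ℝ :=
    { toFun := L
      map_add' := fun a b => tendsto_nhds_unique (hL (a + b))
        (((hL a).add (hL b)).congr fun α => (map_add _ _ _).symm)
      map_smul' := fun c a => tendsto_nhds_unique (hL (c • a))
        (((hL a).const_mul c).congr fun α => by rw [map_smul, smul_eq_mul]) }
  -- The pointwise limit is positive, so it belongs to the order dual. There it is a lower bound of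
  -- the net, and the infimum being `0` forces it to vanish.
  let g : RieszDual E := ofNonneg f fun z hz =>
    ge_of_tendsto (hL z) (Filter.Eventually.of_forall fun α => hnn α z hz)
  have hg : g ≤ 0 := hy.2.2 (by
    rintro _ ⟨α, rfl⟩ z hz
    exact le_of_tendsto (hL z) ((Filter.eventually_ge_atTop α).mono fun β h => hy.1 h z hz))
  have hg0 : g = 0 := le_antisymm hg fun z hz =>
    ge_of_tendsto (hL z) (Filter.Eventually.of_forall fun α => hnn α z hz)
  have hLx : L x = 0 := congrArg (fun h : RieszDual E => h x) hg0
  exact hLx ▸ hL x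

end

end RieszDual

/-! ### Order properties of Arens extensions -/

section ArensOrder

variable {E F : Type*} [AddCommGroup E] [Lattice E] [IsOrderedAddMonoid E] [Module ℝ E]
  [IsOrderedModule ℝ E] [AddCommGroup F] [Lattice F] [IsOrderedAddMonoid F] [Module ℝ F]
  [IsOrderedModule ℝ F]

/-- `arensIter` preserves domination, both in the functionals and in the form. -/
theorem abs_arensIter_le : ∀ {n : ℕ} {x y : Fin n → RieszDual (RieszDual E)}
    {B C : RegularMultilinear n E ℝ}, (∀ i, |x i| ≤ y i) →
    IsPositiveMultilinear (B + C).1 → IsPositiveMultilinear (B - C).1 →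
    |arensIter n x C| ≤ arensIter n y B
  | 0, x, y, B, C, _, h₁, h₂ => by
    have a₁ : 0 ≤ B.1 Fin.elim0 + C.1 Fin.elim0 := h₁ Fin.elim0 fun i => i.elim0
    have a₂ : 0 ≤ B.1 Fin.elim0 - C.1 Fin.elim0 := h₂ Fin.elim0 fun i => i.elim0
    exact abs_le.2 ⟨by change -B.1 Fin.elim0 ≤ C.1 Fin.elim0; linarith,
      by change C.1 Fin.elim0 ≤ B.1 Fin.elim0; linarith⟩
  | n + 1, x, y, B, C, hxy, h₁, h₂ => by
    -- Positivity of `B + C` and `B - C` expresses `|C| ≤ B` without a modulus of forms; this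
    -- estimate passes it on to the forms with one variable fewer.
    have key : ∀ v : Fin n → E, (∀ i, 0 ≤ v i) →
        |x 0 (regularSlice C v)| ≤ y 0 (regularSlice B v) := fun v hv =>
      RieszDual.abs_apply_le (hxy 0) (regularSlice_nonneg h₁ hv) (regularSlice_nonneg h₂ hv)
    refine abs_arensIter_le (B := arensBar (y 0) B) (C := arensBar (x 0) C)
      (fun i => hxy i.succ) (fun v hv => ?_) fun v hv => ?_
    · change 0 ≤ y 0 (regularSlice B v) + x 0 (regularSlice C v)
      linarith [(abs_le.1 (key v hv)).1]
    · change 0 ≤ y 0 (regularSlice B v) - x 0 (regularSlice C v)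
      linarith [(abs_le.1 (key v hv)).2]

/-- With all the other functionals fixed, `arensIter` evaluates the last functional at a point. -/
theorem exists_arensIter_eq_last : ∀ {n : ℕ} (y : Fin n → RieszDual (RieszDual E))
    (A : RegularMultilinear (n + 1) E ℝ),
    ∃ b : RieszDual E, ∀ z : RieszDual (RieszDual E), arensIter (n + 1) (Fin.snoc y z) A = z b
  -- A form in one variable is itself the functional at which `z` is evaluated.
  | 0, _, A => ⟨regularSlice A Fin.elim0, fun _ => rfl⟩
  | n + 1, y, A => by
    obtain ⟨b, h⟩ := exists_arensIter_eq_last (fun i => y i.succ) (arensBar (y 0) A)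
    refine ⟨b, fun z => ?_⟩
    rw [← h z]
    change arensIter (n + 1) (fun i => (Fin.snoc y z : Fin (n + 2) → _) i.succ)
      (arensBar ((Fin.snoc y z : Fin (n + 2) → RieszDual (RieszDual E)) 0) A) = _
    have h0 : (Fin.snoc y z : Fin (n + 2) → RieszDual (RieszDual E)) 0 = y 0 :=
      Fin.snoc_castSucc (α := fun _ => RieszDual (RieszDual E)) z y 0
    have hs : (fun i => (Fin.snoc y z : Fin (n + 2) → RieszDual (RieszDual E)) i.succ)
        = Fin.snoc (fun i => y i.succ) z := by
      funext i
      refine Fin.lastCases ?_ (fun j => ?_) i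
      · rw [Fin.succ_last, Fin.snoc_last, Fin.snoc_last]
      · rw [Fin.succ_castSucc, Fin.snoc_castSucc, Fin.snoc_castSucc]
    rw [h0, hs]

/-- The Arens extension preserves domination. -/
theorem abs_arensExtension_le {m : ℕ} (ρ : Equiv.Perm (Fin m)) {A B : RegularMultilinear m E F}
    (h₁ : IsPositiveMultilinear (B + A).1) (h₂ : IsPositiveMultilinear (B - A).1)
    {x y : Fin m → RieszDual (RieszDual E)} (hxy : ∀ i, |x i| ≤ y i) :
    |arensExtension ρ A x| ≤ arensExtension ρ B y := by
  -- The order of the bidual is tested on positive `f`, and composing with such an `f` keeps `B + A`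
  -- and `B - A` positive.
  have key : ∀ f : RieszDual F, 0 ≤ f →
      |arensExtension ρ A x f| ≤ arensExtension ρ B y f := by
    intro f hf
    refine abs_arensIter_le (fun i => hxy (ρ i)) (fun v hv => ?_) fun v hv => ?_
    · have := hf _ (h₁ (fun i => v (ρ.symm i)) fun i => hv _)
      exact this.trans_eq (map_add f.toLin _ _)
    · have := hf _ (h₂ (fun i => v (ρ.symm i)) fun i => hv _)
      exact this.trans_eq (map_sub f.toLin _ _)
  exact abs_le'.2 ⟨fun f hf => (abs_le.1 (key f hf)).2,
    fun f hf => neg_le.1 (abs_le.1 (key f hf)).1⟩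

/-- The Arens extension of a positive operator is monotone on positive elements. -/
theorem arensExtension_mono {m : ℕ} (ρ : Equiv.Perm (Fin m)) {A : RegularMultilinear m E F}
    (hA : IsPositiveMultilinear A.1) {x y : Fin m → RieszDual (RieszDual E)}
    (hx : ∀ i, 0 ≤ x i) (hxy : ∀ i, x i ≤ y i) :
    arensExtension ρ A x ≤ arensExtension ρ A y :=
  -- A positive operator dominates itself: `A + A` and `A - A = 0` are both positive.
  (le_abs_self _).trans (abs_arensExtension_le ρ (hA.add hA)
    (fun v _ => (sub_self (A.1 v)).ge) fun i => (abs_of_nonneg (hx i)).trans_le (hxy i))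

/-- The Arens extension of a positive operator, of degree at least one, preserves decreasing
convergence to zero along the diagonal. -/
theorem DecreasesToZero.arensExtension {m : ℕ} (hm : 1 ≤ m) (ρ : Equiv.Perm (Fin m))
    {A : RegularMultilinear m E F} (hA : IsPositiveMultilinear A.1) {Ω : Type*} [Preorder Ω]
    [IsDirectedOrder Ω] [Nonempty Ω] {y : Ω → RieszDual (RieszDual E)}
    (hy : DecreasesToZero y) : DecreasesToZero fun α => _root_.arensExtension ρ A fun _ => y α := by
  -- Degree at least one supplies a last slot; in degree zero the extension is constant.
  obtain ⟨n, rfl⟩ := Nat.exists_eq_add_of_le' hm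
  have hnn : ∀ α, 0 ≤ y α := fun α => hy.2.1 ⟨α, rfl⟩
  refine ⟨fun α β h => arensExtension_mono ρ hA (fun _ => hnn β) fun _ => hy.1 h, ?_, ?_⟩
  · rintro _ ⟨α, rfl⟩
    exact (abs_nonneg _).trans (abs_arensExtension_le ρ (hA.add hA)
      (fun v _ => (sub_self (A.1 v)).ge) fun _ => (abs_of_nonneg (hnn α)).le)
  · intro w hw f hf
    obtain ⟨α₀⟩ := ‹Nonempty Ω›
    -- Freezing the first `n` functionals at `y α₀` makes `b` independent of `α`, so a pointwise
    -- limit at `b` suffices.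
    obtain ⟨b, hb⟩ := exists_arensIter_eq_last (fun _ : Fin n => y α₀) (reindexComp ρ A f)
    refine ge_of_tendsto (RieszDual.tendsto_apply_of_decreasesToZero hy b)
      ((Filter.eventually_ge_atTop α₀).mono fun α h => ?_)
    refine (hw ⟨α, rfl⟩ f hf).trans ?_
    -- The tuple is listed in order of evaluation, whereas the extension takes its arguments by
    -- variable; `ρ.symm` translates, and cancels against `ρ` below.
    have hle := arensExtension_mono ρ hA
      (y := fun i => (Fin.snoc (fun _ : Fin n => y α₀) (y α) : Fin (n + 1) → _) (ρ.symm i))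
      (fun _ => hnn α) (fun i => by
        refine Fin.lastCases ?_ (fun j => ?_) (ρ.symm i)
        · rw [Fin.snoc_last]
        · rw [Fin.snoc_castSucc]
          exact hy.1 h) f hf
    refine hle.trans_eq ?_
    rw [← hb]
    change arensIter (n + 1) (fun i => (Fin.snoc (fun _ : Fin n => y α₀) (y α) :
      Fin (n + 1) → RieszDual (RieszDual E)) (ρ.symm (ρ i))) _ = _
    simp only [Equiv.symm_apply_apply]

/-- A regular polynomial is dominated by a positive operator. -/
theorem IsRegularPolynomial.exists_dominating {m : ℕ} {P : E → F}
    (hP : IsRegularPolynomial m P) : ∃ B : RegularMultilinear m E F, IsPositiveMultilinear B.1 ∧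
      ∀ (ρ : Equiv.Perm (Fin m)) {x y : RieszDual (RieszDual E)}, |x| ≤ y →
        |hP.arensExtension ρ x| ≤ _root_.arensExtension ρ B fun _ => y := by
  obtain ⟨A₁, A₂, k₁, k₂, h⟩ := hP.assoc_mem
  -- The two positivity conditions become `2A₁ ≥ 0` and `2A₂ ≥ 0`.
  refine ⟨⟨A₁ + A₂, A₁ + A₂, 0, k₁.add k₂, fun _ _ => le_rfl, by simp⟩, k₁.add k₂,
    fun ρ x y hxy => abs_arensExtension_le ρ (fun v hv => ?_) (fun v hv => ?_) fun _ => hxy⟩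
  · change 0 ≤ A₁ v + A₂ v + hP.isHomogeneousPolynomial.assoc v
    have : A₁ v + A₂ v + hP.isHomogeneousPolynomial.assoc v = A₁ v + A₁ v := by
      rw [h, _root_.sub_apply]
      abel
    rw [this]
    exact add_nonneg (k₁ v hv) (k₁ v hv)
  · change 0 ≤ A₁ v + A₂ v - hP.isHomogeneousPolynomial.assoc v
    have : A₁ v + A₂ v - hP.isHomogeneousPolynomial.assoc v = A₂ v + A₂ v := by
      rw [h, _root_.sub_apply]
      abel
    rw [this]
    exact add_nonneg (k₂ v hv) (k₂ v hv)

end ArensOrder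

/-! ### The three notions of convergence -/

/-- In the definition of `2`-convergence the dominating net may live in any universe. -/
theorem OrderConv₂.of_dominating {X : Type*} [AddCommGroup X] [Lattice X] {Ω Γ : Type*}
    [Preorder Ω] [Preorder Γ] [IsDirectedOrder Γ] [Nonempty Γ] {x : Ω → X} {a : X} {y : Γ → X}
    (hy : DecreasesToZero y) (h : ∀ β, ∃ α₀ : Ω, ∀ α, α₀ ≤ α → |x α - a| ≤ y β) :
    OrderConv₂ x a := by
  -- The net is reindexed by its own values, with the order reversed so that the inclusion into `X`
  -- is decreasing; directedness comes from that of `Γ` because `y` is antitone.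
  refine ⟨(Set.range y)ᵒᵈ, inferInstance, ⟨?_⟩, ⟨OrderDual.toDual ⟨_, Classical.arbitrary Γ, rfl⟩⟩,
    fun z => (OrderDual.ofDual z).1, ⟨fun _ _ hzw => hzw, ?_⟩, ?_⟩
  · rintro ⟨_, β, rfl⟩ ⟨_, γ, rfl⟩
    obtain ⟨δ, hβ, hγ⟩ := exists_ge_ge β γ
    exact ⟨OrderDual.toDual ⟨_, δ, rfl⟩, hy.1 hβ, hy.1 hγ⟩
  · have : Set.range (fun z : (Set.range y)ᵒᵈ => (OrderDual.ofDual z).1) = Set.range y :=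
      Subtype.range_coe
    rw [this]
    exact hy.2
  · rintro ⟨_, β, rfl⟩
    exact h β

theorem mainTheorem5 {E F : Type*}
    [AddCommGroup E] [Lattice E] [IsOrderedAddMonoid E] [Module ℝ E] [IsOrderedModule ℝ E]
    [AddCommGroup F] [Lattice F] [IsOrderedAddMonoid F] [Module ℝ F] [IsOrderedModule ℝ F]
    (m : ℕ) (hm : 1 ≤ m) (P : E → F) (hP : IsRegularPolynomial m P) (ρ : Equiv.Perm (Fin m))
    {Ω : Type*} [Preorder Ω] [IsDirectedOrder Ω] [Nonempty Ω]
    (x'' : Ω → RieszDual (RieszDual E)) :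
    (OrderConv x'' 0 → OrderConv (fun α => hP.arensExtension ρ (x'' α)) 0) ∧
    (OrderConv₁ x'' 0 → OrderConv₁ (fun α => hP.arensExtension ρ (x'' α)) 0) ∧
    (OrderConv₂ x'' 0 → OrderConv₂ (fun α => hP.arensExtension ρ (x'' α)) 0) := by
  obtain ⟨B, hB, hdom⟩ := hP.exists_dominating
  simp only [OrderConv, OrderConv₁, sub_zero]
  refine ⟨?_, ?_, ?_⟩
  · rintro ⟨y, hy, h⟩
    exact ⟨_, hy.arensExtension hm ρ hB, fun α => hdom ρ (h α)⟩
  · rintro ⟨y, α₀, hy, h⟩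
    exact ⟨_, α₀, hy.arensExtension hm ρ hB, fun α hα => hdom ρ (h α hα)⟩
  · rintro ⟨Γ, _, _, _, y, hy, h⟩
    -- `Γ` lies in the universe of `E`, whereas convergence in the bidual of `F` asks for an index
    -- set in the universe of `F`.
    refine .of_dominating (hy.arensExtension hm ρ hB) fun β => ?_
    obtain ⟨α₀, hα₀⟩ := h β
    refine ⟨α₀, fun α hα => ?_⟩
    rw [sub_zero]
    exact hdom ρ (by simpa using hα₀ α hα)
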